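/- For real numbers $\alpha$ and $p>0$, an entire function $f:\mathbb C\to\mathbb C$ and $r>0$, define the Gaussian integral mean $$M_{p,\alpha}(f,r)=\frac{\int_{\{|z|\le r\}}|f(z)|^p e^{-\alpha|z|^2}\,dA(z)}{\int_{\{|z|\le r\}}e^{-\alpha|z|^2}\,dA(z)},$$ where $dA$ is the Euclidean area measure on $\mathbb C$. The function $u(t)=e^{t}-1-t-t^2$ has a unique root $t_0$ on $(0,\infty)$, and $t_0=1.79\cdots$. Let $\alpha<0$, $p>0$, and let $f$ be entire. Then $r\mapsto\ln M_{p,\alpha}(f,r)$ is convex in $\ln r$ for $r\in\left(0,\sqrt{t_0/(-\alpha)}\right)$; that is, $s\mapsto \ln M_{p,\alpha}(f,e^s)$ is convex on $\left(-\infty,\ln\sqrt{t_0/(-\alpha)}\right)$. Here the integrals are finite and the denominator is positive, and $M_{p,\alpha}(f,r)>0$ for all $r>0$ unless $f\equiv 0$ (when $M_{p,\alpha}(f,r)=0$ for all $r$, $\ln M_{p,\alpha}(f,\cdot)$ is constant by convention and the claim is trivial). -/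

import Mathlib

open MeasureTheory

noncomputable section

/-- The Gaussian integral mean `M_{p,α}(f, r)` of `f : ℂ → ℂ`: the average of `|f|^p` over the
closed disc `{z : |z| ≤ r}` with respect to the measure `exp (-α |z|²) dA(z)`, where `dA` is the
Euclidean area measure (the `volume` of `ℂ`). -/
def gaussianMean (p α : ℝ) (f : ℂ → ℂ) (r : ℝ) : ℝ :=
  (∫ z in {z : ℂ | ‖z‖ ≤ r}, ‖f z‖ ^ p * Real.exp (-α * ‖z‖ ^ 2)) /
    (∫ z in {z : ℂ | ‖z‖ ≤ r}, Real.exp (-α * ‖z‖ ^ 2))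

/-- `F` is convex in `ln r` for `r` in the set `I` of positive reals: as a function of the
variable `s = ln r`, it is convex on `ln I`. -/
def ConvexInLogOn (I : Set ℝ) (F : ℝ → ℝ) : Prop :=
  ConvexOn ℝ (Real.log '' I) (fun s => F (Real.exp s))

end

/-! Put β = -α and x = βr². In polar coordinates the Gaussian mean becomes ∫₀ˣ M(t)eᵗ dt / (eˣ - 1),
where M(t) is the mean of |f|^p over the circle of radius √(t/β). Only four facts about M matter: it
is continuous, positive, increasing, and log M is convex in log t (Hardy's theorem).

With respect to log x, the logarithmic derivative of the quotient is A - y, where A = xM(x)eˣ / ∫₀ˣ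
M(t)eᵗ dt and y = xeˣ/(eˣ - 1). If k ≥ 0 is the right derivative of log M in log x, then A' = A(1 +
x + k - A) and y' = y(1 + x - y), so convexity amounts to A(1 + x + k - A) ≥ y(1 + x - y). The left
side is concave in A. The inequality holds at A = y since ky ≥ 0, and is an equality at the larger
root B, so y ≤ A ≤ B suffices (`mul_sub_ge_of_mem_Icc`).

The bound y ≤ A holds because M increases. For A ≤ B, the tangent line of log M gives M(t) ≥
M(x)(t/x)^k, which reduces the claim to M = t^k (`rpow_mul_exp_div_growthBarrier_le`). There it
follows from xB' ≥ xy' (derivatives in x), and this is where eˣ ≤ 1 + x + x², that is x < t₀, is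
used. -/

/-! ### Sub-mean value property of |F|^p -/

open Real Set Filter Topology in
-- Jensen's formula: an entire function has a nonnegative divisor, so every zero in the disc
-- contributes a nonnegative term.
theorem log_norm_le_circleAverage {F : ℂ → ℂ} (hF : Differentiable ℂ F) {c : ℂ} {R : ℝ}
    (hR : 0 < R) (hc : F c ≠ 0) :
    log ‖F c‖ ≤ circleAverage (fun z => log ‖F z‖) c R := by
  have hA : AnalyticOnNhd ℂ F (Metric.closedBall c |R|) := fun z _ => hF.analyticAt z
  rw [hA.circleAverage_log_norm hR.ne' hc]
  refine le_add_of_nonneg_left (finsum_nonneg fun u => ?_)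
  by_cases hu : u ∈ Metric.closedBall c |R|
  · refine mul_nonneg (mod_cast MeromorphicOn.AnalyticOnNhd.divisor_nonneg hA u) ?_
    rcases eq_or_ne c u with h | h
    · simp [h]
    · have h0 : 0 < ‖c - u‖ := norm_pos_iff.2 (sub_ne_zero.2 h)
      have h1 : ‖c - u‖ ≤ R := by
        simpa [Metric.mem_closedBall, dist_eq_norm', abs_of_pos hR] using hu
      exact log_nonneg (by rw [← div_eq_mul_inv]; exact (one_le_div h0).2 h1)
  · simp [Function.locallyFinsuppWithin.apply_eq_zero_of_notMem _ hu]

theorem continuous_norm_rpow {X : Type*} [TopologicalSpace X] {F : X → ℂ} (hF : Continuous F)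
    {p : ℝ} (hp : 0 < p) : Continuous fun z => ‖F z‖ ^ p :=
  hF.norm.rpow_const fun _ => Or.inr hp.le

open Real Set Filter Topology in
/-- The sub-mean value property of `|F|^p` for an entire function `F`. -/
theorem norm_rpow_le_circleAverage {F : ℂ → ℂ} (hF : Differentiable ℂ F) {p : ℝ} (hp : 0 < p)
    (c : ℂ) {R : ℝ} (hR : 0 < R) :
    ‖F c‖ ^ p ≤ circleAverage (fun z => ‖F z‖ ^ p) c R := by
  have hcont : Continuous fun z => ‖F z‖ ^ p := continuous_norm_rpow hF.continuous hp
  by_cases hc : F c = 0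
  · rw [hc, norm_zero, zero_rpow hp.ne']
    exact circleAverage_nonneg_of_nonneg fun z _ => by positivity
  have hFc : 0 < ‖F c‖ := norm_pos_iff.2 hc
  set K : ℝ := ‖F c‖ ^ p with hK
  have hKpos : 0 < K := rpow_pos_of_pos hFc p
  have hlogK : log K = p * log ‖F c‖ := log_rpow hFc p
  -- Since `log 0 = 0`, the value at zeros of F is replaced by `log K - 1`, the choice that makes
  -- the tangent-line bound `hle` an equality there. Such zeros are negligible on the circle.
  set g : ℂ → ℝ := fun z => if F z = 0 then log K - 1 else p * log ‖F z‖ with hg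
  have hcod : g =ᶠ[codiscreteWithin (Metric.sphere c |R|)] fun z => p • log ‖F z‖ := by
    have h1 : F ⁻¹' {0}ᶜ ∈ codiscrete ℂ :=
      AnalyticOnNhd.preimage_zero_mem_codiscrete (x := c) (fun z _ => hF.analyticAt z) hc
    have h2 := codiscreteWithin_mono (subset_univ (Metric.sphere c |R|)) h1
    filter_upwards [h2] with z hz
    have hz' : F z ≠ 0 := by simpa using hz
    simp [hg, hz']
  have hlogint : CircleIntegrable (fun z => log ‖F z‖) c R :=
    MeromorphicOn.circleIntegrable_log_norm fun z _ => (hF.analyticAt z).meromorphicAt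
  have hgint : CircleIntegrable g c R :=
    (circleIntegrable_congr_codiscreteWithin hcod).2 (hlogint.const_smul (a := p))
  have hgavg : circleAverage g c R = p * circleAverage (fun z => log ‖F z‖) c R := by
    rw [circleAverage_congr_codiscreteWithin hcod hR.ne', circleAverage_fun_smul, smul_eq_mul]
  -- This is the tangent to exp at log K, that is log u ≤ u - 1 with u = |F|^p / K.
  have hle : ∀ z, K * g z + (K - K * log K) ≤ ‖F z‖ ^ p := by
    intro z
    by_cases hz : F z = 0
    · simp only [hg, hz, if_true, norm_zero, zero_rpow hp.ne']
      linarith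
    · have hz' : 0 < ‖F z‖ := norm_pos_iff.2 hz
      have hq : 0 < ‖F z‖ ^ p := rpow_pos_of_pos hz' p
      have h := log_le_sub_one_of_pos (div_pos hq hKpos)
      rw [log_div hq.ne' hKpos.ne', log_rpow hz'] at h
      simp only [hg, hz, if_false]
      have h2 := mul_le_mul_of_nonneg_left h hKpos.le
      have h3 : K * (‖F z‖ ^ p / K - 1) = ‖F z‖ ^ p - K := by field_simp
      linarith
  have hconst : CircleIntegrable (fun _ : ℂ => K - K * log K) c R :=
    continuous_const.continuousOn.circleIntegrable'
  have hmulint : CircleIntegrable (fun z => K • g z) c R := hgint.const_smul (a := K)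
  have hmono := circleAverage_mono (hmulint.add hconst)
    (hcont.continuousOn.circleIntegrable' : CircleIntegrable (fun z => ‖F z‖ ^ p) c R)
    (fun z _ => hle z)
  rw [circleAverage_add hmulint hconst, circleAverage_const, circleAverage_fun_smul, hgavg,
    smul_eq_mul] at hmono
  have hJ := log_norm_le_circleAverage hF hR hc
  have h4 : p * log ‖F c‖ ≤ p * circleAverage (fun z => log ‖F z‖) c R :=
    mul_le_mul_of_nonneg_left hJ hp.le
  have h5 := mul_le_mul_of_nonneg_left h4 hKpos.le
  rw [hlogK] at hmono
  linarith

/-! ### Hardy's convexity theorem -/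

open Real Set Filter Topology in
/-- Maximum principle on an interval for a continuous function of the real part with the
sub-mean value property. -/
theorem le_max_of_le_average_cos {g : ℝ → ℝ} (hg : Continuous g)
    (hsub : ∀ s R : ℝ, 0 < R → g s ≤ (2 * π)⁻¹ * ∫ φ in (0 : ℝ)..2 * π, g (s + R * cos φ))
    {a b s : ℝ} (has : a ≤ s) (hsb : s ≤ b) : g s ≤ max (g a) (g b) := by
  have hab : a ≤ b := has.trans hsb
  obtain ⟨x₀, hx₀, hmax⟩ := isCompact_Icc.exists_isMaxOn (nonempty_Icc.2 hab) hg.continuousOn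
  have hSc : IsCompact (Icc a b ∩ g ⁻¹' {g x₀}) :=
    isCompact_Icc.inter_right (isClosed_singleton.preimage hg)
  -- Take the leftmost maximum point m. If it is interior, g is strictly smaller at m - R (the angle
  -- π), so the average cannot reach g m.
  obtain ⟨m, ⟨hm, hgm⟩, hmin⟩ := hSc.exists_isLeast ⟨x₀, hx₀, rfl⟩
  have hgm' : g m = g x₀ := hgm
  have hle : ∀ y ∈ Icc a b, g y ≤ g m := fun y hy => hgm' ▸ hmax hy
  have hsm : g s ≤ g m := hle s ⟨has, hsb⟩
  rcases eq_or_lt_of_le hm.1 with h | ham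
  · exact hsm.trans (h ▸ le_max_left _ _)
  rcases eq_or_lt_of_le hm.2 with h | hmb
  · exact hsm.trans (h ▸ le_max_right _ _)
  exfalso
  set R := min (m - a) (b - m) with hRdef
  have hR : 0 < R := lt_min (by linarith) (by linarith)
  have hmem : ∀ φ, m + R * cos φ ∈ Icc a b := by
    intro φ
    have h1 : R ≤ m - a := min_le_left _ _
    have h2 : R ≤ b - m := min_le_right _ _
    have h3 := neg_one_le_cos φ
    have h4 := cos_le_one φ
    constructor <;> nlinarith
  have hlt : g (m + R * cos π) < g m := by
    refine lt_of_le_of_ne (hle _ (hmem π)) fun h => ?_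
    have := hmin ⟨hmem π, h.trans hgm'⟩
    rw [cos_pi] at this
    linarith
  have hint := intervalIntegral.integral_lt_integral_of_continuousOn_of_le_of_exists_lt
    (f := fun φ => g (m + R * cos φ)) (g := fun _ => g m) two_pi_pos
    (by fun_prop) continuousOn_const (fun φ _ => hle _ (hmem φ))
    ⟨π, ⟨pi_pos.le, by linarith [pi_pos]⟩, hlt⟩
  have h := hsub m R hR
  rw [intervalIntegral.integral_const, smul_eq_mul, sub_zero] at hint
  have h2 := mul_lt_mul_of_pos_left hint (inv_pos.2 two_pi_pos)
  rw [inv_mul_cancel_left₀ two_pi_pos.ne'] at h2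
  linarith

open Real Set Filter Topology in
/-- The weighted integral mean `e^{cs} ∫ |f(e^{s+iθ})|^p dθ` has the sub-mean value property. -/
theorem exp_mul_circleAverage_le {f : ℂ → ℂ} (hf : Differentiable ℂ f) {p : ℝ} (hp : 0 < p)
    (c s : ℝ) {R : ℝ} (hR : 0 < R) :
    exp (c * s) * circleAverage (fun z => ‖f z‖ ^ p) 0 (exp s) ≤
      (2 * π)⁻¹ * ∫ φ in (0 : ℝ)..2 * π, exp (c * (s + R * cos φ)) *
        circleAverage (fun z => ‖f z‖ ^ p) 0 (exp (s + R * cos φ)) := by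
  have hcont : Continuous fun z => ‖f z‖ ^ p := continuous_norm_rpow hf.continuous hp
  have hcm : ∀ t θ : ℝ, circleMap 0 (exp t) θ = Complex.exp (t + θ * Complex.I) := by
    intro t θ
    simp [circleMap, Complex.exp_add]
  have key : ∀ θ : ℝ, exp (c * s) * ‖f (circleMap 0 (exp s) θ)‖ ^ p ≤
      (2 * π)⁻¹ * ∫ φ in (0 : ℝ)..2 * π, exp (c * (s + R * cos φ)) *
        ‖f (circleMap 0 (exp (s + R * cos φ)) (θ + R * sin φ))‖ ^ p := by
    intro θ
    -- In logarithmic coordinates the weight e^{cs} is the p-th power of |exp(cw/p)|, so it is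
    -- absorbed into an entire function.
    set F : ℂ → ℂ := fun w => Complex.exp ((c / p : ℝ) * w) * f (Complex.exp (w + θ * Complex.I))
    have hF : Differentiable ℂ F := by
      refine Differentiable.mul (by fun_prop) (hf.comp (by fun_prop))
    have hnorm : ∀ w : ℂ, ‖F w‖ ^ p =
        exp (c * w.re) * ‖f (Complex.exp (w + θ * Complex.I))‖ ^ p := by
      intro w
      simp only [F, norm_mul]
      rw [mul_rpow (norm_nonneg _) (norm_nonneg _), Complex.norm_exp, ← exp_mul]
      congr 2
      rw [Complex.re_ofReal_mul]
      field_simp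
    have h := norm_rpow_le_circleAverage hF hp (s : ℂ) hR
    rw [circleAverage_def, smul_eq_mul, hnorm] at h
    have e1 : Complex.exp ((s : ℂ) + θ * Complex.I) = circleMap 0 (exp s) θ := (hcm s θ).symm
    rw [e1, Complex.ofReal_re] at h
    refine h.trans_eq ?_
    congr 1
    refine intervalIntegral.integral_congr fun φ _ => ?_
    have e2 : (circleMap (s : ℂ) R φ).re = s + R * cos φ := by
      simp [circleMap, Complex.exp_ofReal_mul_I_re]
    have e3 : Complex.exp (circleMap (s : ℂ) R φ + θ * Complex.I) =
        circleMap 0 (exp (s + R * cos φ)) (θ + R * sin φ) := by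
      rw [hcm]
      congr 1
      simp only [circleMap, Complex.exp_mul_I]
      push_cast
      ring
    simp only [hnorm, e2, e3]
  have hjoint : Continuous (Function.uncurry fun θ φ : ℝ => exp (c * (s + R * cos φ)) *
        ‖f (circleMap 0 (exp (s + R * cos φ)) (θ + R * sin φ))‖ ^ p) := by
    have : Continuous fun q : ℝ × ℝ =>
        circleMap 0 (exp (s + R * cos q.2)) (q.1 + R * sin q.2) := by
      simp only [circleMap]
      fun_prop
    exact Continuous.mul (by fun_prop) (hcont.comp this)
  have hL : Continuous fun θ : ℝ => exp (c * s) * ‖f (circleMap 0 (exp s) θ)‖ ^ p :=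
    continuous_const.mul (hcont.comp (continuous_circleMap 0 (exp s)))
  have hRt := intervalIntegral.continuous_parametric_intervalIntegral_of_continuous'
    (μ := volume) hjoint 0 (2 * π)
  have hmono := intervalIntegral.integral_mono (μ := volume) two_pi_pos.le
    (hL.intervalIntegrable 0 (2 * π))
    ((continuous_const.mul hRt).intervalIntegrable 0 (2 * π)) key
  have hswap := intervalIntegral_intervalIntegral_swap (E := ℝ) (a := 0) (b := 2 * π) (c := 0)
    (d := 2 * π) ((hjoint.continuousOn.integrableOn_compact
      (isCompact_uIcc.prod isCompact_uIcc)).mono_set (prod_mono uIoc_subset_uIcc uIoc_subset_uIcc))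
  simp only [Pi.mul_apply] at hmono
  rw [intervalIntegral.integral_const_mul, intervalIntegral.integral_const_mul, hswap] at hmono
  -- Averaging over θ removes the rotation by R sin φ, leaving a function of the real part only.
  have hinner : ∀ φ : ℝ, ∫ θ in (0 : ℝ)..2 * π, exp (c * (s + R * cos φ)) *
        ‖f (circleMap 0 (exp (s + R * cos φ)) (θ + R * sin φ))‖ ^ p =
      (2 * π) * (exp (c * (s + R * cos φ)) *
        circleAverage (fun z => ‖f z‖ ^ p) 0 (exp (s + R * cos φ))) := by
    intro φ
    rw [intervalIntegral.integral_const_mul, circleAverage_eq_integral_add (R * sin φ),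
      smul_eq_mul]
    field_simp
  simp only [hinner, intervalIntegral.integral_const_mul] at hmono
  have h2 := mul_le_mul_of_nonneg_left hmono (inv_pos.2 two_pi_pos).le
  rw [circleAverage_def, smul_eq_mul]
  rw [inv_mul_cancel_left₀ two_pi_pos.ne'] at h2
  refine le_trans (le_of_eq ?_) h2
  ring

open Real Set Filter Topology in
theorem norm_zero_rpow_le_circleAverage {f : ℂ → ℂ} (hf : Differentiable ℂ f) {p : ℝ}
    (hp : 0 < p) (R : ℝ) : ‖f 0‖ ^ p ≤ circleAverage (fun z => ‖f z‖ ^ p) 0 R := by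
  rcases lt_trichotomy R 0 with h | h | h
  · rw [← circleAverage_neg_radius]
    exact norm_rpow_le_circleAverage hf hp 0 (neg_pos.2 h)
  · rw [h, circleAverage_zero]
  · exact norm_rpow_le_circleAverage hf hp 0 h

open Real Set Filter Topology in
theorem continuous_circleAverage_exp {f : ℂ → ℂ} (hf : Differentiable ℂ f) {p : ℝ} (hp : 0 < p) :
    Continuous fun s : ℝ => circleAverage (fun z => ‖f z‖ ^ p) 0 (exp s) :=
  (continuous_norm_rpow hf.continuous hp).circleAverage.comp continuous_exp

open Real Set Filter Topology in
theorem exp_mul_circleAverage_le_max {f : ℂ → ℂ} (hf : Differentiable ℂ f) {p : ℝ} (hp : 0 < p)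
    (c : ℝ) {a b s : ℝ} (has : a ≤ s) (hsb : s ≤ b) :
    exp (c * s) * circleAverage (fun z => ‖f z‖ ^ p) 0 (exp s) ≤
      max (exp (c * a) * circleAverage (fun z => ‖f z‖ ^ p) 0 (exp a))
        (exp (c * b) * circleAverage (fun z => ‖f z‖ ^ p) 0 (exp b)) :=
  le_max_of_le_average_cos
    (g := fun s => exp (c * s) * circleAverage (fun z => ‖f z‖ ^ p) 0 (exp s))
    (Continuous.mul (by fun_prop) (continuous_circleAverage_exp hf hp))
    (fun s _ hR => exp_mul_circleAverage_le hf hp c s hR) has hsb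

open Real Set Filter Topology in
/-- The integral means of an entire function increase with the radius. -/
theorem circleAverage_norm_rpow_mono {f : ℂ → ℂ} (hf : Differentiable ℂ f) {p : ℝ} (hp : 0 < p) :
    MonotoneOn (fun ρ : ℝ => circleAverage (fun z => ‖f z‖ ^ p) 0 ρ) (Ici 0) := by
  set N : ℝ → ℝ := fun ρ => circleAverage (fun z => ‖f z‖ ^ p) 0 ρ with hN
  have hcont : Continuous N := (continuous_norm_rpow hf.continuous hp).circleAverage
  have h0 : ∀ ρ, N 0 ≤ N ρ := by
    intro ρ
    simp only [hN, circleAverage_zero]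
    exact norm_zero_rpow_le_circleAverage hf hp ρ
  intro x hx y hy hxy
  rcases eq_or_lt_of_le (show 0 ≤ x from hx) with h | hx0
  · rw [← h]
    exact h0 y
  have hy0 : 0 < y := hx0.trans_le hxy
  -- The maximum principle with c = 0 on [log ε, log y]; as ε → 0 the left endpoint value tends to N
  -- 0 ≤ N y.
  have hev : ∀ᶠ ε in 𝓝[>] (0 : ℝ), N x ≤ max (N ε) (N y) := by
    filter_upwards [Ioc_mem_nhdsGT hx0] with ε hε
    have h := exp_mul_circleAverage_le_max hf hp 0 (log_le_log hε.1 hε.2) (log_le_log hx0 hxy)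
    simpa [exp_log hx0, exp_log hy0, exp_log hε.1] using h
  have hlim : Tendsto (fun ε => max (N ε) (N y)) (𝓝[>] 0) (𝓝 (max (N 0) (N y))) :=
    ((hcont.max continuous_const).tendsto 0).mono_left nhdsWithin_le_nhds
  have := ge_of_tendsto hlim hev
  rwa [max_eq_right (h0 y)] at this

open Real Set Filter Topology in
-- If one mean failed to be positive, monotonicity would make f vanish on every smaller circle,
-- hence everywhere.
theorem circleAverage_norm_rpow_pos {f : ℂ → ℂ} (hf : Differentiable ℂ f) (hf0 : f ≠ 0) {p : ℝ}
    (hp : 0 < p) {ρ : ℝ} (hρ : 0 < ρ) : 0 < circleAverage (fun z => ‖f z‖ ^ p) 0 ρ := by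
  have hcont : Continuous fun z => ‖f z‖ ^ p := continuous_norm_rpow hf.continuous hp
  by_contra hneg
  have hθ : ∀ r ∈ Ioc 0 ρ, ∀ θ : ℝ, f (circleMap 0 r θ) = 0 := by
    intro r hr
    by_contra! hex
    obtain ⟨θ, hθ⟩ := hex
    obtain ⟨φ, hφ, hφ'⟩ := (periodic_circleMap 0 r).exists_mem_Ico₀ two_pi_pos θ
    have hpos : 0 < ∫ t in (0 : ℝ)..2 * π, ‖f (circleMap 0 r t)‖ ^ p := by
      have := intervalIntegral.integral_lt_integral_of_continuousOn_of_le_of_exists_lt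
        (f := fun _ => (0 : ℝ)) (g := fun t => ‖f (circleMap 0 r t)‖ ^ p) two_pi_pos
        continuousOn_const (hcont.comp (continuous_circleMap 0 r)).continuousOn
        (fun _ _ => by positivity)
        ⟨φ, ⟨hφ.1, hφ.2.le⟩, rpow_pos_of_pos (norm_pos_iff.2 (hφ' ▸ hθ)) p⟩
      simpa using this
    have h1 : 0 < circleAverage (fun z => ‖f z‖ ^ p) 0 r := by
      rw [circleAverage_def, smul_eq_mul]
      exact mul_pos (inv_pos.2 two_pi_pos) hpos
    exact hneg (h1.trans_le (circleAverage_norm_rpow_mono hf hp hr.1.le hρ.le hr.2))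
  refine hf0 (AnalyticOnNhd.eq_of_eventuallyEq (z₀ := 0) (fun z _ => hf.analyticAt z)
    (fun z _ => analyticAt_const) ?_)
  have hcl : ∀ z ∈ Metric.ball (0 : ℂ) ρ, z ≠ 0 → f z = 0 := by
    intro z hz hz0
    have h := hθ ‖z‖ ⟨norm_pos_iff.2 hz0, by simpa using (Metric.mem_ball.1 hz).le⟩ z.arg
    have e : circleMap 0 ‖z‖ z.arg = z := by simp [circleMap]
    rwa [e] at h
  have hev : f =ᶠ[𝓝[≠] 0] 0 := by
    filter_upwards [self_mem_nhdsWithin, mem_nhdsWithin_of_mem_nhds (Metric.ball_mem_nhds 0 hρ)]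
      with z h1 h2 using hcl z h2 h1
  exact (hf.analyticAt 0).frequently_eq_iff_eventually_eq analyticAt_const |>.1 hev.frequently

open Real Set Filter Topology in
/-- **Hardy's convexity theorem** for an entire function and any exponent `p > 0`. -/
theorem convexOn_log_circleAverage_exp {f : ℂ → ℂ} (hf : Differentiable ℂ f) (hf0 : f ≠ 0) {p : ℝ}
    (hp : 0 < p) :
    ConvexOn ℝ univ fun s : ℝ => log (circleAverage (fun z => ‖f z‖ ^ p) 0 (exp s)) := by
  set m : ℝ → ℝ := fun s => circleAverage (fun z => ‖f z‖ ^ p) 0 (exp s) with hm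
  have hpos : ∀ s, 0 < m s := fun s => circleAverage_norm_rpow_pos hf hf0 hp (exp_pos s)
  refine LinearOrder.convexOn_of_lt convex_univ ?_
  intro a _ b _ hab u v hu hv huv
  -- This slope makes e^{cs}m(s) equal at both endpoints, so the maximum principle becomes the chord
  -- inequality for log m.
  set c : ℝ := -(log (m b) - log (m a)) / (b - a) with hc
  have hba : b - a ≠ 0 := (sub_pos.2 hab).ne'
  have hcm : c * (b - a) = -(log (m b) - log (m a)) := by rw [hc]; field_simp
  obtain rfl : v = 1 - u := by linarith
  have hs1 : a ≤ u • a + (1 - u) • b := by simp only [smul_eq_mul]; nlinarith [mul_pos hv (sub_pos.2 hab)]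
  have hs2 : u • a + (1 - u) • b ≤ b := by simp only [smul_eq_mul]; nlinarith [mul_pos hu (sub_pos.2 hab)]
  have h := exp_mul_circleAverage_le_max hf hp c hs1 hs2
  have hlog : ∀ s, exp (c * s) * m s = exp (c * s + log (m s)) := fun s => by
    rw [exp_add, exp_log (hpos s)]
  change exp _ * m _ ≤ max (exp _ * m a) (exp _ * m b) at h
  rw [hlog, hlog, hlog, show c * b + log (m b) = c * a + log (m a) by linarith, max_self,
    exp_le_exp] at h
  simp only [smul_eq_mul] at h ⊢
  have : (1 - u) * (c * (b - a)) = (1 - u) * -(log (m b) - log (m a)) := by rw [hcm]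
  change log (m _) ≤ _
  linarith

/-! ### The barrier B and the comparison for pure powers -/

/-- The logarithmic derivative `x φ'(x) / φ(x)` of `φ(x) = e^x - 1`. -/
noncomputable def expSubOneLogDeriv (x : ℝ) : ℝ := x * Real.exp x / (Real.exp x - 1)

/-- The larger root `B` of `B (1 + x + k - B) = y (1 + x - y)`, `y = expSubOneLogDeriv x`. -/
noncomputable def growthBarrier (k x : ℝ) : ℝ :=
  ((1 + x + k) + Real.sqrt ((2 * expSubOneLogDeriv x - 1 - x) ^ 2 + 2 * k * (1 + x) + k ^ 2)) / 2

open Real Set Filter Topology in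
theorem hasDerivAt_expSubOneLogDeriv {x : ℝ} (hx : 0 < x) :
    HasDerivAt expSubOneLogDeriv
      (expSubOneLogDeriv x * (1 + x - expSubOneLogDeriv x) / x) x := by
  have hE : exp x - 1 ≠ 0 := (sub_pos.2 (one_lt_exp_iff.2 hx)).ne'
  have h := ((hasDerivAt_id x).mul (hasDerivAt_exp x)).div ((hasDerivAt_exp x).sub_const 1) hE
  refine h.congr_deriv ?_
  simp only [expSubOneLogDeriv, Pi.mul_apply, id]
  field_simp

open Real Set Filter Topology in
theorem expSubOneLogDeriv_pos {x : ℝ} (hx : 0 < x) : 0 < expSubOneLogDeriv x :=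
  div_pos (mul_pos hx (exp_pos x)) (sub_pos.2 (one_lt_exp_iff.2 hx))

open Real Set Filter Topology in
theorem expSubOneLogDeriv_le {x : ℝ} (hx : 0 < x) : expSubOneLogDeriv x ≤ 1 + x := by
  rw [expSubOneLogDeriv, div_le_iff₀ (sub_pos.2 (one_lt_exp_iff.2 hx))]
  linarith [add_one_le_exp x]

open Real Set Filter Topology in
-- After clearing eˣ - 1 this is exactly the hypothesis on eˣ, in the form in which the barrier
-- estimate uses it.
theorem le_mul_expSubOneLogDeriv {x : ℝ} (hx : 0 < x) (hxe : exp x ≤ 1 + x + x ^ 2) :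
    1 + x + x ^ 2 ≤ (1 + x) * expSubOneLogDeriv x := by
  rw [expSubOneLogDeriv, ← mul_div_assoc, le_div_iff₀ (sub_pos.2 (one_lt_exp_iff.2 hx))]
  linarith

/-- Write W = B - y, a = 2y - 1 - x, e = 2C - x. The root equation is W(W + a - k) = ky, and the
claim is eW ≤ Ck. If it fails with e > 0, then C ≥ e gives W > k, so e²ky = eW·e(W + a - k) > Ck·ea.
This contradicts Ca ≥ ey, which is where `hxy` enters. -/
theorem mul_sub_le_of_barrier {k x y B : ℝ} (hk : 0 ≤ k) (hx : 0 < x) (hy : y ≤ 1 + x)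
    (hxy : 1 + x + x ^ 2 ≤ (1 + x) * y) (hB : B * (1 + x + k - B) = y * (1 + x - y))
    (hyB : y ≤ B) :
    (2 * (y * (1 + x - y)) - x) * (B - y) ≤ y * (1 + x - y) * k := by
  have hy1 : 1 ≤ y := by nlinarith
  have hyx : x ≤ y := by nlinarith
  set C := y * (1 + x - y) with hC
  have hC0 : 0 ≤ C := mul_nonneg (by linarith) (by linarith)
  have hCx : C ≤ x := by nlinarith [mul_nonneg (sub_nonneg.2 hy1) (sub_nonneg.2 hyx)]
  have ha : 0 < 2 * y - 1 - x := by nlinarith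
  set a := 2 * y - 1 - x with ha'
  set e := 2 * C - x with he
  obtain ⟨W, rfl⟩ : ∃ W, B = y + W := ⟨B - y, by ring⟩
  have hW0 : 0 ≤ W := by linarith
  rw [add_sub_cancel_left]
  rcases le_or_gt e 0 with he0 | he0
  · exact (mul_nonpos_of_nonpos_of_nonneg he0 hW0).trans (mul_nonneg hC0 hk)
  have hW : W * (W + a - k) = k * y := by rw [ha']; linarith
  have hCa : e * y ≤ C * a := by
    have h1 : (1 + x) * (1 + x - y) ≤ x := by linarith
    have h2 := mul_le_mul_of_nonneg_left h1 (show 0 ≤ y by linarith)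
    have h3 : C * a - e * y = y * x - y * ((1 + x) * (1 + x - y)) := by
      rw [he, ha', hC]; ring
    linarith
  by_contra! hlt
  have h4 : e * a ≤ e * (W + a - k) := by
    have : e * k ≤ C * k := mul_le_mul_of_nonneg_right (by linarith) hk
    linarith
  have hea : 0 < e * a := mul_pos he0 ha
  have h5 : C * k * (e * a) < e * W * (e * (W + a - k)) :=
    (mul_lt_mul_of_pos_right hlt hea).trans_le
      (mul_le_mul_of_nonneg_left h4 (mul_nonneg he0.le hW0))
  have h6 : e * W * (e * (W + a - k)) = e * k * (e * y) := by
    linear_combination e ^ 2 * hW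
  have h7 := mul_le_mul_of_nonneg_left hCa (mul_nonneg he0.le hk)
  linarith

open Real Set Filter Topology in
theorem growthBarrier_root {k x : ℝ} (hk : 0 ≤ k) (hx : 0 < x) :
    growthBarrier k x * (1 + x + k - growthBarrier k x) =
      expSubOneLogDeriv x * (1 + x - expSubOneLogDeriv x) := by
  have h : 0 ≤ (2 * expSubOneLogDeriv x - 1 - x) ^ 2 + 2 * k * (1 + x) + k ^ 2 := by positivity
  have hs := sq_sqrt h
  rw [growthBarrier]
  linear_combination -(1 / 4 : ℝ) * hs

open Real Set Filter Topology in
theorem half_le_growthBarrier {k x : ℝ} (hk : 0 ≤ k) (hx : 0 ≤ x) :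
    1 / 2 ≤ growthBarrier k x := by
  have := sqrt_nonneg ((2 * expSubOneLogDeriv x - 1 - x) ^ 2 + 2 * k * (1 + x) + k ^ 2)
  rw [growthBarrier]
  linarith

open Real Set Filter Topology in
theorem expSubOneLogDeriv_le_growthBarrier {k x : ℝ} (hk : 0 ≤ k) (hx : 0 < x) :
    expSubOneLogDeriv x ≤ growthBarrier k x := by
  have h : 2 * expSubOneLogDeriv x - 1 - x - k ≤
      √((2 * expSubOneLogDeriv x - 1 - x) ^ 2 + 2 * k * (1 + x) + k ^ 2) := by
    refine le_sqrt_of_sq_le ?_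
    nlinarith [mul_nonneg hk (expSubOneLogDeriv_pos hx).le]
  rw [growthBarrier]
  linarith

open Real Set Filter Topology in
-- The square root in B equals 2B - 1 - x - k. Multiplying the derivative bound by it leaves
-- `mul_sub_le_of_barrier`.
theorem exists_hasDerivAt_growthBarrier {k x : ℝ} (hk : 0 ≤ k) (hx : 0 < x)
    (hxe : exp x ≤ 1 + x + x ^ 2) :
    ∃ B', HasDerivAt (growthBarrier k) B' x ∧
      expSubOneLogDeriv x * (1 + x - expSubOneLogDeriv x) ≤ x * B' := by
  have hineq := mul_sub_le_of_barrier hk hx (expSubOneLogDeriv_le hx)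
    (le_mul_expSubOneLogDeriv hx hxe) (growthBarrier_root hk hx)
    (expSubOneLogDeriv_le_growthBarrier hk hx)
  have hxy := le_mul_expSubOneLogDeriv hx hxe
  have hy := hasDerivAt_expSubOneLogDeriv hx
  have ha : 0 < 2 * expSubOneLogDeriv x - 1 - x := by nlinarith
  have hD : 0 < (2 * expSubOneLogDeriv x - 1 - x) ^ 2 + 2 * k * (1 + x) + k ^ 2 := by positivity
  have hder : HasDerivAt
      (fun x => (2 * expSubOneLogDeriv x - 1 - x) ^ 2 + 2 * k * (1 + x) + k ^ 2)
      (2 * (2 * expSubOneLogDeriv x - 1 - x) *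
        (2 * (expSubOneLogDeriv x * (1 + x - expSubOneLogDeriv x) / x) - 1) + 2 * k) x := by
    have h1 := (((hy.const_mul 2).sub_const 1).sub (hasDerivAt_id x)).pow 2
    have h2 := ((hasDerivAt_id x).const_add 1).const_mul (2 * k)
    refine ((h1.add h2).add_const (k ^ 2)).congr_deriv ?_
    simp
  have hB := (((hasDerivAt_id x).const_add 1).add_const k).add (hder.sqrt hD.ne')
    |>.div_const 2
  refine ⟨_, hB, ?_⟩
  have hS : √((2 * expSubOneLogDeriv x - 1 - x) ^ 2 + 2 * k * (1 + x) + k ^ 2) =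
      2 * growthBarrier k x - 1 - x - k := by rw [growthBarrier]; ring
  have hSpos := sqrt_pos.2 hD
  rw [hS] at hSpos ⊢
  set y := expSubOneLogDeriv x
  set B := growthBarrier k x
  set C := y * (1 + x - y)
  have e : x * ((1 + (2 * (2 * y - 1 - x) * (2 * (C / x) - 1) + 2 * k) /
      (2 * (2 * B - 1 - x - k))) / 2) =
      (x + ((2 * y - 1 - x) * (2 * C - x) + k * x) / (2 * B - 1 - x - k)) / 2 := by
    field_simp
  rw [e, le_div_iff₀ two_pos, ← sub_le_iff_le_add', le_div_iff₀ hSpos]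
  linarith

open Real Set Filter Topology in
-- Both sides tend to 0 at the origin, so derivatives are compared. The derivative inequality reads
-- B(1 + t + k - B) ≤ tB', and the root equation turns its left side into y(1 + t - y).
theorem rpow_mul_exp_div_growthBarrier_le {k T : ℝ} (hk : 0 ≤ k)
    (hT : ∀ t, 0 < t → t < T → exp t ≤ 1 + t + t ^ 2) {x : ℝ} (hx : 0 < x) (hxT : x < T) :
    x ^ (k + 1) * exp x / growthBarrier k x ≤ ∫ t in (0 : ℝ)..x, t ^ k * exp t := by
  have hBpos : ∀ t, 0 ≤ t → 0 < growthBarrier k t := fun t ht =>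
    lt_of_lt_of_le (by norm_num) (half_le_growthBarrier hk ht)
  have hcont : Continuous fun t : ℝ => t ^ k * exp t :=
    (continuous_id.rpow_const fun _ => Or.inr hk).mul continuous_exp
  set J : ℝ → ℝ := fun t => t ^ (k + 1) * exp t / growthBarrier k t with hJ
  set I : ℝ → ℝ := fun x => ∫ t in (0 : ℝ)..x, t ^ k * exp t with hI
  have hId : ∀ t, HasDerivAt I (t ^ k * exp t) t := fun t =>
    intervalIntegral.integral_hasDerivAt_right (hcont.intervalIntegrable _ _)
      (hcont.stronglyMeasurableAtFilter _ _) hcont.continuousAt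
  have hJd : ∀ t, 0 < t → t < T → ∃ J', HasDerivAt J J' t ∧ J' ≤ t ^ k * exp t := by
    intro t ht htT
    obtain ⟨B', hB', hle⟩ := exists_hasDerivAt_growthBarrier hk ht (hT t ht htT)
    have h1 : HasDerivAt (fun t : ℝ => t ^ (k + 1)) ((k + 1) * t ^ k) t := by
      simpa using hasDerivAt_rpow_const (p := k + 1) (Or.inl ht.ne')
    refine ⟨_, (h1.mul (hasDerivAt_exp t)).div hB' (hBpos t ht.le).ne', ?_⟩
    simp only [Pi.mul_apply]
    rw [rpow_add_one ht.ne', div_le_iff₀ (pow_pos (hBpos t ht.le) 2)]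
    rw [← growthBarrier_root hk ht] at hle
    have hp : 0 ≤ t ^ k * exp t := by positivity
    have := mul_le_mul_of_nonneg_left hle hp
    linarith
  have hmono : ∀ ε, 0 < ε → ε ≤ x → J x ≤ I x + J ε := by
    intro ε hε hεx
    have hM : MonotoneOn (fun t => I t - J t) (Icc ε x) := by
      have hd : ∀ t ∈ Icc ε x, ∃ d, HasDerivAt (fun t => I t - J t) d t ∧ 0 ≤ d := by
        intro t ht
        obtain ⟨J', h1, h2⟩ := hJd t (hε.trans_le ht.1) (ht.2.trans_lt hxT)
        exact ⟨_, (hId t).sub h1, sub_nonneg.2 h2⟩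
      refine monotoneOn_of_deriv_nonneg (convex_Icc ε x) (fun t ht => ?_) (fun t ht => ?_)
        (fun t ht => ?_)
      · obtain ⟨d, h, -⟩ := hd t ht
        exact h.continuousAt.continuousWithinAt
      · obtain ⟨d, h, -⟩ := hd t (interior_subset ht)
        exact h.differentiableAt.differentiableWithinAt
      · obtain ⟨d, h, h0⟩ := hd t (interior_subset ht)
        rwa [h.deriv]
    have h := hM (left_mem_Icc.2 hεx) (right_mem_Icc.2 hεx) hεx
    have hI0 : 0 ≤ I ε := intervalIntegral.integral_nonneg hε.le fun t ht =>
      mul_nonneg (rpow_nonneg ht.1 k) (exp_pos t).le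
    simp only at h
    linarith
  -- The crude bound B ≥ 1/2 is enough to make the boundary term J ε vanish in the limit.
  have hev : ∀ᶠ ε in 𝓝[>] (0 : ℝ), J x ≤ I x + 2 * (ε ^ (k + 1) * exp ε) := by
    filter_upwards [Ioc_mem_nhdsGT hx] with ε hε
    refine (hmono ε hε.1 hε.2).trans (add_le_add_right ?_ _)
    rw [hJ]
    simp only
    rw [div_le_iff₀ (hBpos ε hε.1.le)]
    have h0 : 0 ≤ ε ^ (k + 1) * exp ε := mul_nonneg (rpow_nonneg hε.1.le _) (exp_pos ε).le
    have := mul_le_mul_of_nonneg_left (half_le_growthBarrier hk hε.1.le) h0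
    linarith
  have hc : Continuous fun ε : ℝ => I x + 2 * (ε ^ (k + 1) * exp ε) := by
    have : Continuous fun ε : ℝ => ε ^ (k + 1) :=
      continuous_id.rpow_const fun _ => Or.inr (by linarith)
    fun_prop
  have hlim := (hc.tendsto 0).mono_left (nhdsWithin_le_nhds (s := Ioi 0))
  rw [zero_rpow (by linarith), zero_mul, mul_zero, add_zero] at hlim
  exact ge_of_tendsto hlim hev

/-! ### Exponentially weighted averages of a log-convex mean -/

/-- `log M(e^s)` is convex, `M` is increasing, positive and continuous: the properties of the
integral means of an entire function that the convexity theorem uses. -/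
structure IsLogConvexMean (M : ℝ → ℝ) : Prop where
  continuous : Continuous M
  pos : ∀ x, 0 < x → 0 < M x
  monotoneOn : MonotoneOn M (Set.Ici 0)
  convexOn : ConvexOn ℝ Set.univ fun s => Real.log (M (Real.exp s))

open Real Set Filter Topology in
theorem ConvexOn.add_rightDeriv_mul_le {L : ℝ → ℝ} (hL : ConvexOn ℝ univ L) {σ s : ℝ}
    (h : σ < s) : L s + derivWithin L (Ioi s) s * (σ - s) ≤ L σ := by
  have h1 := hL.slope_le_leftDeriv_of_mem_interior (mem_univ σ) (y := s) (by simp) h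
  have h2 := hL.leftDeriv_le_rightDeriv_of_mem_interior (x := s) (by simp)
  have h3 := h1.trans h2
  rw [slope_def_field, div_le_iff₀ (sub_pos.2 h)] at h3
  linarith

/-- A concave quadratic on [y, B] is at least the smaller of its endpoint values, here y(c - y) + ky
and y(c - y). -/
theorem mul_sub_ge_of_mem_Icc {A y B c k : ℝ} (hk : 0 ≤ k) (hy : 0 ≤ y) (hyA : y ≤ A)
    (hAB : A ≤ B) (hB : B * (c + k - B) = y * (c - y)) : y * (c - y) ≤ A * (c + k - A) := by
  rcases eq_or_lt_of_le hAB with rfl | hlt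
  · exact hB.ge
  have h1 : (y - B) * (c + k - y - B) = k * y := by linarith
  have h2 : c + k - y - B ≤ 0 := by
    by_contra! h
    have := mul_neg_of_neg_of_pos (sub_neg.2 (hyA.trans_lt hlt)) h
    linarith [mul_nonneg hk hy]
  have h3 : 0 ≤ (B - A) * (A + B - c - k) := mul_nonneg (by linarith) (by linarith)
  linarith

namespace IsLogConvexMean

variable {M : ℝ → ℝ}

open Real Set Filter Topology in
theorem integral_pos (hM : IsLogConvexMean M) {x : ℝ} (hx : 0 < x) :
    0 < ∫ t in (0 : ℝ)..x, M t * exp t := by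
  refine intervalIntegral.intervalIntegral_pos_of_pos_on ?_
    (fun t ht => mul_pos (hM.pos t ht.1) (exp_pos t)) hx
  exact (hM.continuous.mul continuous_exp).intervalIntegrable _ _

open Real Set Filter Topology in
theorem expSubOneLogDeriv_le (hM : IsLogConvexMean M) {x : ℝ} (hx : 0 < x) :
    expSubOneLogDeriv x ≤ x * M x * exp x / ∫ t in (0 : ℝ)..x, M t * exp t := by
  have hE := sub_pos.2 (one_lt_exp_iff.2 hx)
  have h : ∫ t in (0 : ℝ)..x, M t * exp t ≤ M x * (exp x - 1) := by
    have h1 : ∫ t in (0 : ℝ)..x, M x * exp t = M x * (exp x - 1) := by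
      rw [intervalIntegral.integral_const_mul, integral_exp, exp_zero]
    rw [← h1]
    refine intervalIntegral.integral_mono_on hx.le
      ((hM.continuous.mul continuous_exp).intervalIntegrable _ _)
      ((continuous_const.mul continuous_exp).intervalIntegrable _ _) fun t ht => ?_
    exact mul_le_mul_of_nonneg_right (hM.monotoneOn ht.1 hx.le ht.2) (exp_pos t).le
  rw [expSubOneLogDeriv, div_le_div_iff₀ hE (hM.integral_pos hx)]
  have := mul_le_mul_of_nonneg_left h (mul_pos hx (exp_pos x)).le
  linarith

open Real Set Filter Topology in
-- The supporting line of the convex function log M(e^s) at s, exponentiated.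
theorem rpow_div_le (hM : IsLogConvexMean M) (s : ℝ) {t : ℝ} (ht0 : 0 < t) (hts : t < exp s) :
    M (exp s) * (t / exp s) ^ derivWithin (fun s => log (M (exp s))) (Ioi s) s ≤ M t := by
  set k := derivWithin (fun s => log (M (exp s))) (Ioi s) s
  have h := hM.convexOn.add_rightDeriv_mul_le (σ := log t) (s := s) ((log_lt_iff_lt_exp ht0).2 hts)
  simp only [exp_log ht0] at h
  rw [← exp_log (hM.pos t ht0), ← exp_log (hM.pos _ (exp_pos s)),
    rpow_def_of_pos (div_pos ht0 (exp_pos s)), ← exp_add, exp_le_exp,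
    log_div ht0.ne' (exp_pos s).ne', log_exp]
  linarith

open Real Set Filter Topology in
theorem rightDeriv_nonneg (hM : IsLogConvexMean M) (s : ℝ) :
    0 ≤ derivWithin (fun s => log (M (exp s))) (Ioi s) s := by
  refine MonotoneOn.derivWithin_nonneg (Monotone.monotoneOn (fun a b hab => ?_) _)
  exact log_le_log (hM.pos _ (exp_pos a))
    (hM.monotoneOn (exp_pos a).le (exp_pos b).le (exp_le_exp.2 hab))

open Real Set Filter Topology in
theorem le_growthBarrier (hM : IsLogConvexMean M) {T : ℝ}
    (hT : ∀ t, 0 < t → t < T → exp t ≤ 1 + t + t ^ 2) {s : ℝ} (hs : exp s < T) :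
    exp s * M (exp s) * exp (exp s) / ∫ t in (0 : ℝ)..exp s, M t * exp t ≤
      growthBarrier (derivWithin (fun s => log (M (exp s))) (Ioi s) s) (exp s) := by
  have hk := hM.rightDeriv_nonneg s
  have hle := fun t => hM.rpow_div_le s (t := t)
  set k := derivWithin (fun s => log (M (exp s))) (Ioi s) s
  set x := exp s with hx'
  have hx : 0 < x := exp_pos s
  have hB : 0 < growthBarrier k x :=
    lt_of_lt_of_le (by norm_num) (half_le_growthBarrier hk hx.le)
  have hcont : Continuous fun t : ℝ => t ^ k * exp t :=
    (continuous_id.rpow_const fun _ => Or.inr hk).mul continuous_exp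
  have h1 : M x / x ^ k * ∫ t in (0 : ℝ)..x, t ^ k * exp t ≤
      ∫ t in (0 : ℝ)..x, M t * exp t := by
    rw [← intervalIntegral.integral_const_mul]
    refine intervalIntegral.integral_mono_on_of_le_Ioo hx.le
      ((continuous_const.mul hcont).intervalIntegrable _ _)
      ((hM.continuous.mul continuous_exp).intervalIntegrable _ _) fun t ht => ?_
    rw [← mul_assoc]
    refine mul_le_mul_of_nonneg_right ?_ (exp_pos t).le
    have h := hle t ht.1 ht.2
    rw [div_rpow ht.1.le hx.le] at h
    exact (le_of_eq (by ring)).trans h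
  have h2 := rpow_mul_exp_div_growthBarrier_le hk hT hx hs
  have hxk : 0 < x ^ k := rpow_pos_of_pos hx k
  have h3 := (mul_le_mul_of_nonneg_left h2 (div_pos (hM.pos x hx) hxk).le).trans h1
  rw [rpow_add_one hx.ne'] at h3
  have h4 : M x / x ^ k * (x ^ k * x * exp x / growthBarrier k x) =
      x * M x * exp x / growthBarrier k x := by field_simp
  rw [h4, div_le_iff₀ hB] at h3
  rw [div_le_iff₀ (hM.integral_pos hx)]
  linarith

open Real Set Filter Topology in
theorem hasDerivAt_integral_exp (hM : IsLogConvexMean M) (s : ℝ) :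
    HasDerivAt (fun s => ∫ t in (0 : ℝ)..exp s, M t * exp t)
      (exp s * M (exp s) * exp (exp s)) s := by
  have hcont := hM.continuous.mul continuous_exp
  have h : HasDerivAt (fun x => ∫ t in (0 : ℝ)..x, M t * exp t) (M (exp s) * exp (exp s))
      (exp s) :=
    intervalIntegral.integral_hasDerivAt_right (hcont.intervalIntegrable _ _)
      (hcont.stronglyMeasurableAtFilter _ _) hcont.continuousAt
  exact (h.comp s (hasDerivAt_exp s)).congr_deriv (by ring)

open Real Set Filter Topology in
-- The Riccati equation for A. It is one-sided because convexity supplies only the right derivative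
-- k.
theorem hasDerivWithinAt_logDeriv (hM : IsLogConvexMean M) (s : ℝ) :
    HasDerivWithinAt
      (fun s => exp s * M (exp s) * exp (exp s) / ∫ t in (0 : ℝ)..exp s, M t * exp t)
      ((exp s * M (exp s) * exp (exp s) / ∫ t in (0 : ℝ)..exp s, M t * exp t) *
        (1 + exp s + derivWithin (fun s => log (M (exp s))) (Ioi s) s -
          exp s * M (exp s) * exp (exp s) / ∫ t in (0 : ℝ)..exp s, M t * exp t)) (Ici s) s := by
  have hL := (hM.convexOn.hasDerivWithinAt_rightDeriv_of_mem_interior (x := s) (by simp)).Ici_of_Ioi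
  set k := derivWithin (fun s => log (M (exp s))) (Ioi s) s
  have hMd : HasDerivWithinAt (fun s => M (exp s)) (M (exp s) * k) (Ici s) s := by
    have h := hL.exp
    simp only [exp_log (hM.pos _ (exp_pos _))] at h
    exact h
  have he := (hasDerivAt_exp s).hasDerivWithinAt (s := Ici s)
  have hn := (he.mul hMd).mul he.exp
  have hpos := hM.integral_pos (exp_pos s)
  refine (hn.div (hM.hasDerivAt_integral_exp s).hasDerivWithinAt hpos.ne').congr_deriv ?_
  simp only [Pi.mul_apply]
  field_simp
  ring

open Real Set Filter Topology in
theorem monotoneOn_logDeriv_sub (hM : IsLogConvexMean M) {T : ℝ} (hT0 : 0 < T)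
    (hT : ∀ t, 0 < t → t < T → exp t ≤ 1 + t + t ^ 2) :
    MonotoneOn (fun s => (exp s * M (exp s) * exp (exp s) / ∫ t in (0 : ℝ)..exp s, M t * exp t) -
      expSubOneLogDeriv (exp s)) (Iio (log T)) := by
  intro a _ b hb hab
  set A : ℝ → ℝ := fun s => exp s * M (exp s) * exp (exp s) / ∫ t in (0 : ℝ)..exp s, M t * exp t
  have hy : ∀ s, HasDerivAt (fun s => expSubOneLogDeriv (exp s))
      (expSubOneLogDeriv (exp s) * (1 + exp s - expSubOneLogDeriv (exp s))) s := fun s =>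
    ((hasDerivAt_expSubOneLogDeriv (exp_pos s)).comp s (hasDerivAt_exp s)).congr_deriv
      (div_mul_cancel₀ _ (exp_pos s).ne')
  have hAc : Continuous A := by
    have hc : Continuous fun s => M (exp s) := hM.continuous.comp continuous_exp
    have hI : Continuous fun s => ∫ t in (0 : ℝ)..exp s, M t * exp t :=
      continuous_iff_continuousAt.2 fun s => (hM.hasDerivAt_integral_exp s).continuousAt
    exact ((continuous_exp.mul hc).mul (by fun_prop)).div hI
      fun s => (hM.integral_pos (exp_pos s)).ne'
  -- A comparison principle needing only right derivatives: y stays below A shifted to agree with it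
  -- at a.
  have h := image_le_of_deriv_right_le_deriv_boundary
    (f := fun s => expSubOneLogDeriv (exp s)) (a := a) (b := b)
    (B := fun s => A s - (A a - expSubOneLogDeriv (exp a)))
    (fun s _ => (hy s).continuousAt.continuousWithinAt) (fun s _ => (hy s).hasDerivWithinAt)
    (by simp) (hAc.sub continuous_const).continuousOn
    (fun s _ => (hM.hasDerivWithinAt_logDeriv s).sub_const _) (fun s hs => ?_)
    (right_mem_Icc.2 hab)
  · simp only at h ⊢
    linarith
  · have hsT : exp s < T := (lt_log_iff_exp_lt hT0).1 (hs.2.trans hb)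
    have hk := hM.rightDeriv_nonneg s
    exact mul_sub_ge_of_mem_Icc hk (expSubOneLogDeriv_pos (exp_pos s)).le
      (hM.expSubOneLogDeriv_le (exp_pos s)) (hM.le_growthBarrier hT hsT)
      (growthBarrier_root hk (exp_pos s))

open Real Set Filter Topology in
/-- The exponentially weighted averages of `M` on `[0, x]` are logarithmically convex in `log x`
as long as `e^x ≤ 1 + x + x²`. -/
theorem convexOn_log_average (hM : IsLogConvexMean M) {T : ℝ} (hT0 : 0 < T)
    (hT : ∀ t, 0 < t → t < T → exp t ≤ 1 + t + t ^ 2) :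
    ConvexOn ℝ (Iio (log T))
      fun s => log ((∫ t in (0 : ℝ)..exp s, M t * exp t) / (exp (exp s) - 1)) := by
  have hE : ∀ s, 0 < exp (exp s) - 1 := fun s => sub_pos.2 (one_lt_exp_iff.2 (exp_pos s))
  have hd : ∀ s, HasDerivAt
      (fun s => log ((∫ t in (0 : ℝ)..exp s, M t * exp t) / (exp (exp s) - 1)))
      ((exp s * M (exp s) * exp (exp s) / ∫ t in (0 : ℝ)..exp s, M t * exp t) -
        expSubOneLogDeriv (exp s)) s := by
    intro s
    have h1 := (hM.hasDerivAt_integral_exp s).log (hM.integral_pos (exp_pos s)).ne'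
    have h2 := ((hasDerivAt_exp s).exp.sub_const 1).log (hE s).ne'
    have h3 := h1.sub h2
    refine (h3.congr_deriv ?_).congr_of_eventuallyEq (Eventually.of_forall fun u => ?_)
    · rw [expSubOneLogDeriv, mul_comm (exp (exp s)) (exp s)]
    · exact log_div (hM.integral_pos (exp_pos u)).ne' (hE u).ne'
  refine MonotoneOn.convexOn_of_deriv (convex_Iio _)
    (fun s _ => (hd s).continuousAt.continuousWithinAt)
    (fun s _ => (hd s).differentiableAt.differentiableWithinAt) ?_
  rw [interior_Iio]
  exact (hM.monotoneOn_logDeriv_sub hT0 hT).congr fun s _ => (hd s).deriv.symm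

end IsLogConvexMean

/-! ### The root t₀, via (1 + t + t²)e⁻ᵗ, which rises on [0, 1] and falls afterwards -/

open Real Set Filter Topology in
theorem hasDerivAt_one_add_add_sq_mul_exp_neg (t : ℝ) :
    HasDerivAt (fun t => (1 + t + t ^ 2) * exp (-t)) (t * (1 - t) * exp (-t)) t := by
  have h1 := ((hasDerivAt_id t).const_add 1).add (hasDerivAt_pow 2 t)
  refine (h1.mul (hasDerivAt_neg t).exp).congr_deriv ?_
  simp
  ring

open Real Set Filter Topology in
theorem exp_lt_one_add_add_sq {t : ℝ} (h0 : 0 < t) (h1 : t ≤ 1) : exp t < 1 + t + t ^ 2 := by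
  have hmono : StrictMonoOn (fun t => (1 + t + t ^ 2) * exp (-t)) (Icc 0 1) := by
    refine strictMonoOn_of_deriv_pos (convex_Icc 0 1)
      (fun t _ => (hasDerivAt_one_add_add_sq_mul_exp_neg t).continuousAt.continuousWithinAt) ?_
    intro t ht
    rw [interior_Icc] at ht
    rw [(hasDerivAt_one_add_add_sq_mul_exp_neg t).deriv]
    exact mul_pos (mul_pos ht.1 (sub_pos.2 ht.2)) (exp_pos _)
  have h := hmono (left_mem_Icc.2 zero_le_one) ⟨h0.le, h1⟩ h0
  simp only [neg_zero, exp_zero, exp_neg] at h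
  rw [← div_eq_mul_inv, lt_div_iff₀ (exp_pos t)] at h
  linarith

open Real Set Filter Topology in
theorem strictAntiOn_one_add_add_sq_mul_exp_neg :
    StrictAntiOn (fun t : ℝ => (1 + t + t ^ 2) * exp (-t)) (Ici 1) := by
  refine strictAntiOn_of_deriv_neg (convex_Ici 1)
    (fun t _ => (hasDerivAt_one_add_add_sq_mul_exp_neg t).continuousAt.continuousWithinAt) ?_
  intro t ht
  rw [interior_Ici] at ht
  rw [(hasDerivAt_one_add_add_sq_mul_exp_neg t).deriv]
  have ht' : 1 < t := ht
  exact mul_neg_of_neg_of_pos (mul_neg_of_pos_of_neg (by linarith) (by linarith)) (exp_pos _)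

open Real Set Filter Topology in
theorem one_add_add_sq_mul_exp_neg_of_root {t : ℝ} (ht : exp t - 1 - t - t ^ 2 = 0) :
    (1 + t + t ^ 2) * exp (-t) = 1 := by
  rw [show 1 + t + t ^ 2 = exp t by linarith, ← exp_add, add_neg_cancel, exp_zero]

open Real Set Filter Topology in
theorem one_lt_of_root {t : ℝ} (h0 : 0 < t) (ht : exp t - 1 - t - t ^ 2 = 0) : 1 < t := by
  by_contra! h
  linarith [exp_lt_one_add_add_sq h0 h]

open Real Set Filter Topology in
theorem exp_le_of_lt_root {t₀ t : ℝ} (ht₀ : 0 < t₀) (hroot : exp t₀ - 1 - t₀ - t₀ ^ 2 = 0)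
    (h0 : 0 < t) (htt : t < t₀) : exp t ≤ 1 + t + t ^ 2 := by
  rcases le_or_gt t 1 with h | h
  · exact (exp_lt_one_add_add_sq h0 h).le
  have := strictAntiOn_one_add_add_sq_mul_exp_neg h.le (one_lt_of_root ht₀ hroot).le htt
  simp only [one_add_add_sq_mul_exp_neg_of_root hroot] at this
  rw [exp_neg, ← div_eq_mul_inv, lt_div_iff₀ (exp_pos t)] at this
  linarith

open Real Set Filter Topology in
theorem root_unique {t₀ t : ℝ} (ht₀ : 0 < t₀) (hroot : exp t₀ - 1 - t₀ - t₀ ^ 2 = 0)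
    (h0 : 0 < t) (ht : exp t - 1 - t - t ^ 2 = 0) : t = t₀ :=
  strictAntiOn_one_add_add_sq_mul_exp_neg.injOn (one_lt_of_root h0 ht).le
    (one_lt_of_root ht₀ hroot).le
    ((one_add_add_sq_mul_exp_neg_of_root ht).trans (one_add_add_sq_mul_exp_neg_of_root hroot).symm)

open Real Set Filter Topology in
theorem exists_root :
    ∃ t₀ : ℝ, (1.79 ≤ t₀ ∧ t₀ < 1.80) ∧ exp t₀ - 1 - t₀ - t₀ ^ 2 = 0 := by
  have hlo : exp (1.79 : ℝ) < 5.992 := by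
    -- The Taylor bound requires an argument at most 1, so 1.79 is halved and the estimate squared.
    -- The target 5.992 lies below 1 + 1.79 + 1.79² = 5.9941.
    have h := exp_bound' (x := 0.895) (by norm_num) (by norm_num) (n := 8) (by norm_num)
    simp only [Finset.sum_range_succ, Finset.sum_range_zero, Nat.factorial] at h
    have h2 : exp (0.895 : ℝ) ≤ 2.4475 := h.trans (by norm_num)
    have h3 : exp (1.79 : ℝ) = exp 0.895 ^ 2 := by rw [← exp_nat_mul]; norm_num
    rw [h3]
    nlinarith [exp_pos (0.895 : ℝ)]
  have hhi : 6.045 < exp (1.80 : ℝ) := by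
    have h := sum_le_exp_of_nonneg (x := 1.80) (by norm_num) 10
    simp only [Finset.sum_range_succ, Finset.sum_range_zero, Nat.factorial] at h
    exact lt_of_lt_of_le (by norm_num) h
  obtain ⟨t, ht, h⟩ := intermediate_value_Ico (f := fun t : ℝ => exp t - 1 - t - t ^ 2)
    (a := 1.79) (b := 1.80) (by norm_num) (by fun_prop)
    (show (0 : ℝ) ∈ Ico _ _ from ⟨by norm_num at hlo ⊢; linarith, by norm_num at hhi ⊢; linarith⟩)
  exact ⟨t, ht, h⟩

/-! ### From disc integrals to one-dimensional averages -/

open Real Set Filter Topology in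
/-- Integration over a disc in polar coordinates. -/
theorem setIntegral_disc_eq {G : ℂ → ℝ} (hG : Continuous G) {r : ℝ} (hr : 0 < r) :
    ∫ z in {z : ℂ | ‖z‖ ≤ r}, G z =
      ∫ ρ in (0 : ℝ)..r, ρ * (2 * π * circleAverage G 0 ρ) := by
  have hmeas : MeasurableSet {z : ℂ | ‖z‖ ≤ r} := measurableSet_le measurable_norm measurable_const
  rw [← integral_indicator hmeas, ← Complex.integral_comp_polarCoord_symm]
  have hset : polarCoord.target = Ioi (0 : ℝ) ×ˢ Ioo (-π) π := rfl
  have hcm : ∀ q : ℝ × ℝ, Complex.polarCoord.symm q = circleMap 0 q.1 q.2 := by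
    intro q
    simp [Complex.polarCoord_symm_apply, circleMap, Complex.exp_mul_I]
  set K : ℝ × ℝ → ℝ := fun q => q.1 * G (circleMap 0 q.1 q.2) with hK
  have hKc : Continuous K := by
    have : Continuous fun q : ℝ × ℝ => circleMap 0 q.1 q.2 := by
      simp only [circleMap]; fun_prop
    exact continuous_fst.mul (hG.comp this)
  have hind : ∀ q ∈ polarCoord.target,
      q.1 • ({z : ℂ | ‖z‖ ≤ r}.indicator G) (Complex.polarCoord.symm q) =
        (Iic r ×ˢ univ).indicator K q := by
    intro q hq
    rw [hset] at hq
    have hq1 : 0 < q.1 := hq.1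
    have hn : ‖circleMap 0 q.1 q.2‖ = q.1 := by simp [abs_of_pos hq1]
    rw [hcm]
    by_cases hqr : q.1 ≤ r
    · rw [indicator_of_mem (show _ ∈ {z : ℂ | ‖z‖ ≤ r} from hn.trans_le hqr),
        indicator_of_mem (show q ∈ Iic r ×ˢ univ from ⟨hqr, mem_univ _⟩), smul_eq_mul]
    · rw [indicator_of_notMem (show _ ∉ {z : ℂ | ‖z‖ ≤ r} from fun h => hqr (hn ▸ h)),
        indicator_of_notMem (show q ∉ Iic r ×ˢ univ from fun h => hqr h.1), smul_zero]
  rw [setIntegral_congr_fun (by rw [hset]; exact measurableSet_Ioi.prod measurableSet_Ioo) hind,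
    setIntegral_indicator (measurableSet_Iic.prod MeasurableSet.univ), hset, prod_inter_prod,
    inter_univ, Ioi_inter_Iic, Measure.volume_eq_prod, setIntegral_prod]
  · rw [intervalIntegral.integral_of_le hr.le]
    refine setIntegral_congr_fun measurableSet_Ioc fun ρ _ => ?_
    simp only [hK]
    -- Polar angles run over (-π, π) and circle averages over [0, 2π]; a shift by -π matches them.
    rw [integral_const_mul, ← integral_Ioc_eq_integral_Ioo,
      ← intervalIntegral.integral_of_le (by linarith [pi_pos]), circleAverage_eq_integral_add (-π),
      smul_eq_mul, intervalIntegral.integral_comp_add_right (fun θ => G (circleMap 0 ρ θ)),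
      mul_inv_cancel_left₀ two_pi_pos.ne']
    congr 2 <;> ring
  · rw [← Measure.volume_eq_prod]
    exact (hKc.continuousOn.integrableOn_compact (isCompact_Icc.prod isCompact_Icc)).mono_set
      (prod_mono Ioc_subset_Icc_self Ioo_subset_Icc_self)

open Real Set Filter Topology in
theorem setIntegral_disc_mul_exp_eq {G : ℂ → ℝ} (hG : Continuous G) {β r : ℝ} (hβ : 0 < β)
    (hr : 0 < r) :
    ∫ z in {z : ℂ | ‖z‖ ≤ r}, G z * exp (β * ‖z‖ ^ 2) =
      π / β * ∫ t in (0 : ℝ)..β * r ^ 2, circleAverage G 0 √(t / β) * exp t := by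
  rw [setIntegral_disc_eq (G := fun z => G z * exp (β * ‖z‖ ^ 2)) (hG.mul (by fun_prop)) hr]
  have hsub := intervalIntegral.integral_comp_mul_deriv (a := 0) (b := r)
    (f := fun ρ => β * ρ ^ 2) (f' := fun ρ => 2 * β * ρ)
    (g := fun t => circleAverage G 0 √(t / β) * exp t)
    (fun ρ _ => ((hasDerivAt_pow 2 ρ).const_mul β).congr_deriv (by simp; ring))
    (by fun_prop) (Continuous.mul (hG.circleAverage.comp (by fun_prop)) continuous_exp)
  simp only [ne_eq, OfNat.ofNat_ne_zero, not_false_eq_true, zero_pow, mul_zero,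
    Function.comp_def] at hsub
  rw [← hsub, ← intervalIntegral.integral_const_mul]
  refine intervalIntegral.integral_congr fun ρ hρ => ?_
  rw [uIcc_of_le hr.le] at hρ
  have h1 : circleAverage (fun z => G z * exp (β * ‖z‖ ^ 2)) 0 ρ =
      circleAverage G 0 ρ * exp (β * ρ ^ 2) := by
    simp [circleAverage_def, mul_assoc]
  have h2 : √(β * ρ ^ 2 / β) = ρ := by
    rw [mul_div_cancel_left₀ _ hβ.ne', sqrt_sq hρ.1]
  simp only [h1, h2]
  field_simp

theorem ConvexOn.comp_mul_add_const {L : ℝ → ℝ} {S S' : Set ℝ} (hL : ConvexOn ℝ S L) (m c : ℝ)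
    (hS' : Convex ℝ S') (hmaps : ∀ x ∈ S', m * x + c ∈ S) :
    ConvexOn ℝ S' fun x => L (m * x + c) := by
  refine ⟨hS', fun x hx y hy a b ha hb hab => ?_⟩
  have h := hL.2 (hmaps x hx) (hmaps y hy) ha hb hab
  convert h using 2
  simp only [smul_eq_mul]
  linear_combination -c * hab

open Real Set Filter Topology in
theorem isLogConvexMean_circleAverage {f : ℂ → ℂ} (hf : Differentiable ℂ f) (hf0 : f ≠ 0) {p β : ℝ}
    (hp : 0 < p) (hβ : 0 < β) :
    IsLogConvexMean fun t => circleAverage (fun z => ‖f z‖ ^ p) 0 √(t / β) where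
  continuous := (continuous_norm_rpow hf.continuous hp).circleAverage.comp (by fun_prop)
  pos x hx := circleAverage_norm_rpow_pos hf hf0 hp (sqrt_pos.2 (div_pos hx hβ))
  monotoneOn x _ y _ hxy := circleAverage_norm_rpow_mono hf hp (sqrt_nonneg _) (sqrt_nonneg _)
    (sqrt_le_sqrt (div_le_div_of_nonneg_right hxy hβ.le))
  convexOn := by
    have h := (convexOn_log_circleAverage_exp hf hf0 hp).comp_mul_add_const (1 / 2)
      (-(1 / 2 * log β)) convex_univ fun _ _ => mem_univ _
    refine h.congr fun s _ => ?_
    have e : √(exp s / β) = exp (1 / 2 * s + -(1 / 2 * log β)) := by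
      have h1 : exp s / β = exp (1 / 2 * s + -(1 / 2 * log β)) ^ 2 := by
        rw [← exp_nat_mul, show ((2 : ℕ) : ℝ) * (1 / 2 * s + -(1 / 2 * log β)) = s - log β by
          push_cast; ring, exp_sub, exp_log hβ]
      rw [h1, sqrt_sq (exp_pos _).le]
    simp only [e]

open Real Set Filter Topology in
theorem setIntegral_disc_exp_eq {β r : ℝ} (hβ : 0 < β) (hr : 0 < r) :
    ∫ z in {z : ℂ | ‖z‖ ≤ r}, exp (β * ‖z‖ ^ 2) = π / β * (exp (β * r ^ 2) - 1) := by
  have h := setIntegral_disc_mul_exp_eq (G := fun _ => 1) continuous_const hβ hr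
  simpa [circleAverage_const] using h

open Real Set Filter Topology in
theorem gaussianMean_eq {f : ℂ → ℂ} (hf : Continuous f) {p α r : ℝ} (hp : 0 < p) (hα : α < 0)
    (hr : 0 < r) :
    gaussianMean p α f r =
      (∫ t in (0 : ℝ)..(-α) * r ^ 2, circleAverage (fun z => ‖f z‖ ^ p) 0 √(t / -α) * exp t) /
        (exp ((-α) * r ^ 2) - 1) := by
  have hβ : 0 < -α := neg_pos.2 hα
  rw [gaussianMean, setIntegral_disc_mul_exp_eq (continuous_norm_rpow hf hp) hβ hr,
    setIntegral_disc_exp_eq hβ hr, mul_div_mul_left _ _ (div_pos pi_pos hβ).ne']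

open Real Set Filter Topology in
theorem integrableOn_disc {G : ℂ → ℝ} (hG : Continuous G) (r : ℝ) :
    IntegrableOn G {z : ℂ | ‖z‖ ≤ r} := by
  have h : {z : ℂ | ‖z‖ ≤ r} = Metric.closedBall 0 r := by ext; simp
  rw [h]
  exact hG.continuousOn.integrableOn_compact (isCompact_closedBall 0 r)

open Real Set Filter Topology in
theorem gaussianMean_pos {f : ℂ → ℂ} (hf : Differentiable ℂ f) (hf0 : f ≠ 0) {p α r : ℝ}
    (hp : 0 < p) (hα : α < 0) (hr : 0 < r) : 0 < gaussianMean p α f r := by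
  have hβ : 0 < -α := neg_pos.2 hα
  have hx : 0 < (-α) * r ^ 2 := by positivity
  rw [gaussianMean_eq hf.continuous hp hα hr]
  exact div_pos ((isLogConvexMean_circleAverage hf hf0 hp hβ).integral_pos hx)
    (sub_pos.2 (one_lt_exp_iff.2 hx))

/-! ### Convexity of the Gaussian mean -/

open Real Set Filter Topology in
theorem log_image_Ioo_zero {R : ℝ} (hR : 0 < R) : log '' Ioo 0 R = Iio (log R) := by
  ext s
  constructor
  · rintro ⟨r, hr, rfl⟩
    exact log_lt_log hr.1 hr.2
  · intro hs
    exact ⟨exp s, ⟨exp_pos s, (lt_log_iff_exp_lt hR).1 hs⟩, log_exp s⟩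

open Real Set Filter Topology in
theorem convexInLogOn_log_gaussianMean {f : ℂ → ℂ} (hf : Differentiable ℂ f) {p α T : ℝ}
    (hp : 0 < p) (hα : α < 0) (hT0 : 0 < T)
    (hT : ∀ t, 0 < t → t < T → exp t ≤ 1 + t + t ^ 2) :
    ConvexInLogOn (Ioo 0 √(T / -α)) fun r => log (gaussianMean p α f r) := by
  have hβ : 0 < -α := neg_pos.2 hα
  rw [ConvexInLogOn, log_image_Ioo_zero (sqrt_pos.2 (div_pos hT0 hβ))]
  by_cases hf0 : f = 0
  · simpa [hf0, gaussianMean, zero_rpow hp.ne'] using convexOn_const (0 : ℝ) (convex_Iio _)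
  -- Since x = βr², log x = 2 log r + log β, an affine change that preserves convexity.
  have h := ((isLogConvexMean_circleAverage hf hf0 hp hβ).convexOn_log_average hT0
    hT).comp_mul_add_const (S' := Iio (log √(T / -α))) 2 (log (-α)) (convex_Iio _) fun s hs => by
      rw [mem_Iio, log_sqrt (div_pos hT0 hβ).le, log_div hT0.ne' hβ.ne'] at hs
      rw [mem_Iio]
      linarith
  refine h.congr fun s _ => ?_
  have e : exp (2 * s + log (-α)) = (-α) * exp s ^ 2 := by
    rw [exp_add, exp_log hβ, ← exp_nat_mul, mul_comm]
    push_cast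
    rfl
  simp only [gaussianMean_eq hf.continuous hp hα (exp_pos s), e]

theorem corollary1 :
    ∃ t₀ : ℝ,
      (0 < t₀ ∧ Real.exp t₀ - 1 - t₀ - t₀ ^ 2 = 0) ∧
      (∀ t : ℝ, 0 < t → Real.exp t - 1 - t - t ^ 2 = 0 → t = t₀) ∧
      (1.79 ≤ t₀ ∧ t₀ < 1.80) ∧
      ∀ (α p : ℝ), α < 0 → 0 < p → ∀ f : ℂ → ℂ, Differentiable ℂ f →
        (∀ r : ℝ, 0 < r →
          IntegrableOn (fun z : ℂ => ‖f z‖ ^ p * Real.exp (-α * ‖z‖ ^ 2)) {z : ℂ | ‖z‖ ≤ r} ∧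
          IntegrableOn (fun z : ℂ => Real.exp (-α * ‖z‖ ^ 2)) {z : ℂ | ‖z‖ ≤ r} ∧
          0 < ∫ z in {z : ℂ | ‖z‖ ≤ r}, Real.exp (-α * ‖z‖ ^ 2)) ∧
        (f ≠ 0 → ∀ r : ℝ, 0 < r → 0 < gaussianMean p α f r) ∧
        ConvexInLogOn (Set.Ioo 0 (Real.sqrt (t₀ / (-α))))
          (fun r => Real.log (gaussianMean p α f r)) := by
  obtain ⟨t₀, hb, hroot⟩ := exists_root
  have ht₀ : 0 < t₀ := lt_of_lt_of_le (by norm_num) hb.1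
  refine ⟨t₀, ⟨ht₀, hroot⟩, fun t h0 h => root_unique ht₀ hroot h0 h, hb, ?_⟩
  intro α p hα hp f hf
  have hβ : 0 < -α := neg_pos.2 hα
  refine ⟨fun r hr => ⟨?_, ?_, ?_⟩, fun hf0 r hr => gaussianMean_pos hf hf0 hp hα hr,
    convexInLogOn_log_gaussianMean hf hp hα ht₀ fun t h0 h => exp_le_of_lt_root ht₀ hroot h0 h⟩
  · exact integrableOn_disc ((continuous_norm_rpow hf.continuous hp).mul (by fun_prop)) r
  · exact integrableOn_disc (by fun_prop) r
  · rw [setIntegral_disc_exp_eq hβ hr]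
    exact mul_pos (div_pos Real.pi_pos hβ)
      (sub_pos.2 (Real.one_lt_exp_iff.2 (by positivity)))
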